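/- Let $n\ge 1$, $D>0$, and let $X=(x_{jk})_{1\le j,k\le n}$ be a random self-adjoint $n\times n$ complex matrix (so $x_{jj}\in\mathbb R$ and $x_{jk}=\overline{x_{kj}}$ for $k<j$) whose entries $x_{jk}$, $1\le j\le k\le n$, are independent random variables such that 1. for $1\le j\le n$, $x_{jj}$ is supported in a real interval of length at most $\sqrt2\,D$; and 2. for $1\le j<k\le n$, either $x_{jk}$ is supported in a subset of $\mathbb C$ of diameter at most $D$, or $x_{jk}=w_{jk}(\alpha_{jk}+i\beta_{jk})$, where $w_{jk}\in\mathbb C$ is a constant with $|w_{jk}|\le 1$ and $\alpha_{jk},\beta_{jk}$ are independent real random variables, each supported in an interval of length at most $D$. Let $\lambda_1(X)\ge\lambda_2(X)\ge\dots\ge\lambda_n(X)$ be the eigenvalues of $X$, counted with multiplicity. Then, for any median $\mathbb M\lambda_1(X)$ of $\lambda_1(X)$, $$\mathbb P\bigl[|\lambda_1(X)-\mathbb M\lambda_1(X)|\ge t\bigr]\le 4e^{-t^2/(8D^2)}\qquad\text{for all } t>0,$$ and the same holds with $\lambda_1(X)$ replaced by $\lambda_n(X)$. Furthermore, there are real numbers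 $M_k$, $2\le k\le n-1$, such that for each $2\le k\le n-1$ and all $t>0$, $$\mathbb P\bigl[|\lambda_k(X)-M_k|\ge t\bigr]\le 8\exp\left[-\left(\frac{t}{2\sqrt2\,(\sqrt k+\sqrt{k-1})D}\right)^2\right]\le 8\exp\left[-\frac{t^2}{32kD^2}\right],$$ and the same upper bounds (with the same $k$) hold if $\lambda_k(X)$ is replaced by $\lambda_{n-k+1}(X)$ and $M_k$ by $M_{n-k+1}$. -/

import Mathlib

open MeasureTheory ProbabilityTheory

/-- The real random variable `Y` is supported in an interval of length at most `L`. -/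
def SupportedInInterval {Ω : Type*} [MeasurableSpace Ω] (μ : Measure Ω) (Y : Ω → ℝ) (L : ℝ) :
    Prop :=
  ∃ a b : ℝ, b - a ≤ L ∧ ∀ᵐ ω ∂μ, Y ω ∈ Set.Icc a b

/-- The complex random variable `Z` is supported in a set of diameter at most `D`. (Boundedness is
required because `Metric.diam` is `0` on unbounded sets.) -/
def SupportedInDiam {Ω : Type*} [MeasurableSpace Ω] (μ : Measure Ω) (Z : Ω → ℂ) (D : ℝ) : Prop :=
  ∃ S : Set ℂ, Bornology.IsBounded S ∧ Metric.diam S ≤ D ∧ ∀ᵐ ω ∂μ, Z ω ∈ S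

/-- `Z = w (α + i β)` with a constant `w`, `|w| ≤ 1`, and independent real random variables
`α`, `β`, each supported in an interval of length at most `D`. -/
def IsScaledIndepPair {Ω : Type*} [MeasurableSpace Ω] (μ : Measure Ω) (Z : Ω → ℂ) (D : ℝ) :
    Prop :=
  ∃ (w : ℂ) (α β : Ω → ℝ), ‖w‖ ≤ 1 ∧ Measurable α ∧ Measurable β ∧ IndepFun α β μ ∧
    SupportedInInterval μ α D ∧ SupportedInInterval μ β D ∧
    ∀ᵐ ω ∂μ, Z ω = w * ((α ω : ℂ) + Complex.I * (β ω : ℂ))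

/-- `m` is a median of the real random variable `Y`. -/
def IsMedian {Ω : Type*} [MeasurableSpace Ω] (μ : Measure Ω) (Y : Ω → ℝ) (m : ℝ) : Prop :=
  1 / 2 ≤ μ.real {ω | Y ω ≤ m} ∧ 1 / 2 ≤ μ.real {ω | m ≤ Y ω}

/-- The `k`-th largest eigenvalue `λ_k` (`1 ≤ k ≤ n`), counted with multiplicity, of a self-adjoint
`n × n` matrix, so that `λ_1 ≥ λ_2 ≥ ⋯ ≥ λ_n`; the value is `0` for `k` out of range. Mathlib's
`eigenvalues₀` lists the eigenvalues in decreasing order, starting at index `0`. -/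
noncomputable def kthEigenvalue {n : ℕ} {A : Matrix (Fin n) (Fin n) ℂ} (hA : A.IsHermitian)
    (k : ℕ) : ℝ :=
  if h : 1 ≤ k ∧ k ≤ n then
    hA.eigenvalues₀ ⟨k - 1, by rw [Fintype.card_fin]; omega⟩
  else 0

/-! By Ky Fan's principle, the sum `topSum` of the k largest eigenvalues is the maximum of
`frameSum` over orthonormal k-frames. Each `frameSum` is linear in the matrix, so `topSum` is
convex; by Bessel and Cauchy–Schwarz it is √k-Lipschitz for the Hilbert–Schmidt norm.

Convex Lipschitz functions of independent bounded variables concentrate. This is obtained from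
Maurey's convex property (τ): it holds for a law supported in a set of diameter d with cost
‖x‖²/(4d²) (`convexTau_of_diam`), passes to linear images (`ConvexTau.map`), and tensorizes
(`ConvexTau.prod`, `ConvexTau.pi`). Applied to a truncated multiple of a convex G with G x - G y ≤ L
√c(x - y), it bounds P(G ≤ a) P(G ≥ a + t) by exp(-t²/L²), hence the deviation from any median by 4
exp(-t²/L²). For `topSum` of order k the entry costs give L² = 8kD².

The case k = 1 is the bound for λ_1. For k ≥ 2, λ_k is the difference of two consecutive such sums;
splitting t in the ratio √k : √(k-1) makes their two bounds equal. The lower end of the spectrum is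
handled by passing to -X. -/

/-- Among weights in `[0, 1]` of total mass `k`, an antitone sequence has the largest weighted sum
for the indicator of the first `k` indices. -/
lemma sum_mul_le_sum_castLE {n k : ℕ} (hk : k ≤ n) {l p : Fin n → ℝ} (hl : Antitone l)
    (hp0 : ∀ j, 0 ≤ p j) (hp1 : ∀ j, p j ≤ 1) (hp : ∑ j, p j = k) :
    ∑ j, l j * p j ≤ ∑ i : Fin k, l (Fin.castLE hk i) := by
  rcases Nat.eq_zero_or_pos k with rfl | hk0
  · have h0 : ∀ j, p j = 0 := by
      have := (Finset.sum_eq_zero_iff_of_nonneg (fun j _ => hp0 j)).1 (by simpa using hp)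
      simpa using this
    simp [h0]
  set c := l ⟨k - 1, by omega⟩ with hc
  have hind : ∀ g : Fin n → ℝ, ∑ i : Fin k, g (Fin.castLE hk i) =
      ∑ j, g j * (if (j : ℕ) < k then 1 else 0) := by
    intro g
    simp only [mul_ite, mul_one, mul_zero, ← Finset.sum_filter]
    refine Finset.sum_bij (fun i _ => Fin.castLE hk i) (fun i _ => by simp)
      (fun a _ b _ h => by simpa using h) (fun j hj => ?_) (fun _ _ => rfl)
    exact ⟨⟨j, by simpa using hj⟩, Finset.mem_univ _, rfl⟩
  have hcount : ∑ j : Fin n, (if (j : ℕ) < k then (1 : ℝ) else 0) = k := by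
    have := hind (fun _ => 1)
    simp only [one_mul] at this
    rw [← this]; simp
  rw [hind]
  -- Both weight families have total mass k, so subtracting the threshold value c changes nothing
  -- after summation, while it gives every term a sign.
  have hterm : ∀ j : Fin n, (l j - c) * (p j - (if (j : ℕ) < k then 1 else 0)) ≤ 0 := by
    intro j
    split_ifs with hj
    · exact mul_nonpos_of_nonneg_of_nonpos
        (sub_nonneg.2 (hl (by rw [Fin.le_def]; simp; omega))) (by linarith [hp1 j])
    · exact mul_nonpos_of_nonpos_of_nonneg
        (sub_nonpos.2 (hl (by rw [Fin.le_def]; simp; omega))) (by linarith [hp0 j])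
  have hsum := Finset.sum_nonpos (fun j (_ : j ∈ Finset.univ) => hterm j)
  simp only [sub_mul, mul_sub, Finset.sum_sub_distrib, ← Finset.mul_sum, hp, hcount] at hsum
  linarith

/-! ### Ky Fan's principle: convexity and Lipschitz bound for sums of the largest eigenvalues. -/

section KyFan

variable {n k : ℕ}

/-- The sum of the values of the quadratic form of `A` at the vectors `v i`. -/
noncomputable def frameSum (A : Matrix (Fin n) (Fin n) ℂ) (v : Fin k → EuclideanSpace ℂ (Fin n)) :
    ℝ :=
  ∑ i, (inner ℂ (v i) (Matrix.toEuclideanLin A (v i))).re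

lemma frameSum_add (A B : Matrix (Fin n) (Fin n) ℂ) (v : Fin k → EuclideanSpace ℂ (Fin n)) :
    frameSum (A + B) v = frameSum A v + frameSum B v := by
  simp [frameSum, Finset.sum_add_distrib]

lemma frameSum_smul (a : ℝ) (A : Matrix (Fin n) (Fin n) ℂ)
    (v : Fin k → EuclideanSpace ℂ (Fin n)) :
    frameSum ((a : ℂ) • A) v = a * frameSum A v := by
  simp only [frameSum, map_smul, LinearMap.smul_apply, inner_smul_right, Complex.re_ofReal_mul,
    Finset.mul_sum]

lemma frameSum_eq_sum_mul {A : Matrix (Fin n) (Fin n) ℂ} {l : Fin n → ℝ}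
    (u : OrthonormalBasis (Fin n) ℂ (EuclideanSpace ℂ (Fin n)))
    (hu : ∀ i, Matrix.toEuclideanLin A (u i) = (l i : ℂ) • u i)
    (v : Fin k → EuclideanSpace ℂ (Fin n)) :
    frameSum A v = ∑ j, l j * ∑ i, ‖inner ℂ (u j) (v i)‖ ^ 2 := by
  have h : ∀ x, (inner ℂ x (Matrix.toEuclideanLin A x)).re = ∑ j, l j * ‖inner ℂ (u j) x‖ ^ 2 := by
    intro x
    conv_lhs => rw [← u.sum_repr' x, map_sum]
    rw [u.sum_repr' x]
    simp only [map_smul, hu, inner_sum, inner_smul_right, Complex.re_sum]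
    refine Finset.sum_congr rfl fun j _ => ?_
    rw [mul_left_comm, ← inner_conj_symm x (u j), ← RCLike.star_def, Complex.star_def,
      Complex.mul_conj, Complex.normSq_eq_norm_sq, ← Complex.ofReal_mul, Complex.ofReal_re]
  simp only [frameSum, h, Finset.mul_sum]
  exact Finset.sum_comm

/-- In the eigenbasis u, the eigenvalue l j gets the weight ∑ᵢ |⟨u j, v i⟩|². Bessel for the frame v
bounds each weight by 1; Parseval for u gives total mass k. -/
lemma frameSum_le_of_orthonormal {A : Matrix (Fin n) (Fin n) ℂ} {l : Fin n → ℝ}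
    (hl : Antitone l) (u : OrthonormalBasis (Fin n) ℂ (EuclideanSpace ℂ (Fin n)))
    (hu : ∀ i, Matrix.toEuclideanLin A (u i) = (l i : ℂ) • u i) (hk : k ≤ n)
    {v : Fin k → EuclideanSpace ℂ (Fin n)} (hv : Orthonormal ℂ v) :
    frameSum A v ≤ ∑ i : Fin k, l (Fin.castLE hk i) := by
  rw [frameSum_eq_sum_mul u hu]
  refine sum_mul_le_sum_castLE hk hl (fun j => by positivity) (fun j => ?_) ?_
  · have := hv.sum_inner_products_le (u j) (s := Finset.univ)
    simpa [norm_inner_symm] using this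
  · rw [Finset.sum_comm]
    simp [u.sum_sq_norm_inner_right, hv.1]

lemma frameSum_eigenvectors {A : Matrix (Fin n) (Fin n) ℂ} {l : Fin n → ℝ}
    (u : OrthonormalBasis (Fin n) ℂ (EuclideanSpace ℂ (Fin n)))
    (hu : ∀ i, Matrix.toEuclideanLin A (u i) = (l i : ℂ) • u i) (hk : k ≤ n) :
    frameSum A (fun i : Fin k => u (Fin.castLE hk i)) = ∑ i : Fin k, l (Fin.castLE hk i) := by
  simp [frameSum, hu]

lemma orthonormal_castLE (u : OrthonormalBasis (Fin n) ℂ (EuclideanSpace ℂ (Fin n)))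
    (hk : k ≤ n) : Orthonormal ℂ (fun i : Fin k => u (Fin.castLE hk i)) :=
  u.orthonormal.comp _ (Fin.castLE_injective hk)

/-- The antitone sequence of eigenvalues of a matrix does not depend on the eigenbasis. -/
lemma eigenvalues_unique {A : Matrix (Fin n) (Fin n) ℂ} {l l' : Fin n → ℝ}
    (hl : Antitone l) (hl' : Antitone l')
    (u u' : OrthonormalBasis (Fin n) ℂ (EuclideanSpace ℂ (Fin n)))
    (hu : ∀ i, Matrix.toEuclideanLin A (u i) = (l i : ℂ) • u i)
    (hu' : ∀ i, Matrix.toEuclideanLin A (u' i) = (l' i : ℂ) • u' i) : l = l' := by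
  -- Each partial sum is attained by its own eigenvectors and bounds every other frame, so the two
  -- agree; consecutive differences recover the individual values.
  have hsum : ∀ m (hm : m ≤ n),
      ∑ i : Fin m, l (Fin.castLE hm i) = ∑ i : Fin m, l' (Fin.castLE hm i) := by
    intro m hm
    apply le_antisymm
    · rw [← frameSum_eigenvectors u hu hm]
      exact frameSum_le_of_orthonormal hl' u' hu' hm (orthonormal_castLE u hm)
    · rw [← frameSum_eigenvectors u' hu' hm]
      exact frameSum_le_of_orthonormal hl u hu hm (orthonormal_castLE u' hm)
  funext i
  have h1 := hsum (i + 1) i.2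
  rw [Fin.sum_univ_castSucc, Fin.sum_univ_castSucc] at h1
  have h2 := hsum i i.2.le
  have h3 : Fin.castLE i.2 (Fin.last (i : ℕ)) = i := by ext; simp
  rw [h3] at h1
  have h4 : ∀ j : Fin (i : ℕ), Fin.castLE i.2 j.castSucc = Fin.castLE i.2.le j := fun j => by
    ext; simp
  simp only [h4] at h1
  linarith

lemma antitone_kthEigenvalue {A : Matrix (Fin n) (Fin n) ℂ} (hA : A.IsHermitian) :
    Antitone (fun i : Fin n => kthEigenvalue hA (i + 1)) := by
  intro i j hij
  simp only [kthEigenvalue]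
  rw [dif_pos (by omega), dif_pos (by omega)]
  exact hA.eigenvalues₀_antitone (by rw [Fin.le_def] at hij ⊢; simpa using hij)

lemma exists_eigenbasis {A : Matrix (Fin n) (Fin n) ℂ} (hA : A.IsHermitian) :
    ∃ u : OrthonormalBasis (Fin n) ℂ (EuclideanSpace ℂ (Fin n)),
      ∀ i, Matrix.toEuclideanLin A (u i) = (kthEigenvalue hA (i + 1) : ℂ) • u i := by
  refine ⟨((Matrix.isSymmetric_toEuclideanLin_iff.mpr hA).eigenvectorBasis
    finrank_euclideanSpace).reindex (finCongr (Fintype.card_fin n)), fun i => ?_⟩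
  rw [OrthonormalBasis.reindex_apply, LinearMap.IsSymmetric.apply_eigenvectorBasis, kthEigenvalue,
    dif_pos (by omega)]
  rfl

/-- The reversed eigenbasis of A is an eigenbasis of -A with decreasing eigenvalues, so uniqueness
applies. -/
lemma kthEigenvalue_neg {A : Matrix (Fin n) (Fin n) ℂ} (hA : A.IsHermitian)
    (hA' : (-A).IsHermitian) {j : ℕ} (hj1 : 1 ≤ j) (hjn : j ≤ n) :
    kthEigenvalue hA' j = -kthEigenvalue hA (n - j + 1) := by
  obtain ⟨u, hu⟩ := exists_eigenbasis hA
  obtain ⟨u', hu'⟩ := exists_eigenbasis hA'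
  have := eigenvalues_unique (A := -A) (l := fun i : Fin n => kthEigenvalue hA' (i + 1))
    (l' := fun i : Fin n => -kthEigenvalue hA (i.rev + 1)) (antitone_kthEigenvalue hA')
    (fun i j hij => neg_le_neg (antitone_kthEigenvalue hA (Fin.rev_le_rev.2 hij)))
    u' (u.reindex Fin.revPerm) hu' (fun i => by simp [hu])
  have h := congrFun this ⟨j - 1, by omega⟩
  simp only [Fin.val_rev] at h
  rw [show j - 1 + 1 = j by omega] at h
  exact h

/-- The sum of the `k` largest eigenvalues. -/
noncomputable def topSum {A : Matrix (Fin n) (Fin n) ℂ} (hA : A.IsHermitian) (k : ℕ) : ℝ :=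
  ∑ i : Fin k, kthEigenvalue hA (i + 1)

lemma topSum_succ {A : Matrix (Fin n) (Fin n) ℂ} (hA : A.IsHermitian) (k : ℕ) :
    topSum hA (k + 1) = topSum hA k + kthEigenvalue hA (k + 1) := by
  simp [topSum, Fin.sum_univ_castSucc]

lemma topSum_one {A : Matrix (Fin n) (Fin n) ℂ} (hA : A.IsHermitian) :
    topSum hA 1 = kthEigenvalue hA 1 := by
  simp [topSum]

lemma frameSum_le_topSum {A : Matrix (Fin n) (Fin n) ℂ} (hA : A.IsHermitian) (hk : k ≤ n)
    {v : Fin k → EuclideanSpace ℂ (Fin n)} (hv : Orthonormal ℂ v) :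
    frameSum A v ≤ topSum hA k := by
  obtain ⟨u, hu⟩ := exists_eigenbasis hA
  exact frameSum_le_of_orthonormal (antitone_kthEigenvalue hA) u hu hk hv

lemma exists_frameSum_eq_topSum {A : Matrix (Fin n) (Fin n) ℂ} (hA : A.IsHermitian) (hk : k ≤ n) :
    ∃ v : Fin k → EuclideanSpace ℂ (Fin n), Orthonormal ℂ v ∧ frameSum A v = topSum hA k := by
  obtain ⟨u, hu⟩ := exists_eigenbasis hA
  exact ⟨_, orthonormal_castLE u hk, frameSum_eigenvectors u hu hk⟩

/-- Bessel's inequality for the frame v, applied to the conjugate of each row of A. -/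
lemma sum_norm_sq_apply_le (A : Matrix (Fin n) (Fin n) ℂ)
    {v : Fin k → EuclideanSpace ℂ (Fin n)} (hv : Orthonormal ℂ v) :
    ∑ i, ‖Matrix.toEuclideanLin A (v i)‖ ^ 2 ≤ ∑ r, ∑ s, ‖A r s‖ ^ 2 := by
  simp only [EuclideanSpace.norm_sq_eq]
  rw [Finset.sum_comm]
  refine Finset.sum_le_sum fun r _ => ?_
  have h := hv.sum_inner_products_le (WithLp.toLp 2 fun s => star (A r s)) (s := Finset.univ)
  rw [EuclideanSpace.norm_sq_eq] at h
  simp only [norm_star] at h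
  refine le_trans (le_of_eq (Finset.sum_congr rfl fun i _ => ?_)) h
  congr 1
  rw [← norm_star (_ : ℂ)]
  congr 1
  simp [PiLp.inner_apply, Matrix.mulVec, dotProduct, Matrix.toLpLin_apply]

lemma frameSum_le_sqrt (A : Matrix (Fin n) (Fin n) ℂ)
    {v : Fin k → EuclideanSpace ℂ (Fin n)} (hv : Orthonormal ℂ v) :
    frameSum A v ≤ √k * √(∑ r, ∑ s, ‖A r s‖ ^ 2) := by
  have h1 : frameSum A v ≤ ∑ i, ‖Matrix.toEuclideanLin A (v i)‖ := by
    refine Finset.sum_le_sum fun i _ => (Complex.re_le_norm _).trans ?_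
    simpa [hv.1] using norm_inner_le_norm (𝕜 := ℂ) (v i) (Matrix.toEuclideanLin A (v i))
  rw [← Real.sqrt_mul (by positivity)]
  refine h1.trans (Real.le_sqrt_of_sq_le ?_)
  have h2 := sq_sum_le_card_mul_sum_sq (s := Finset.univ)
    (f := fun i : Fin k => ‖Matrix.toEuclideanLin A (v i)‖)
  rw [Finset.card_univ, Fintype.card_fin] at h2
  exact h2.trans (mul_le_mul_of_nonneg_left (sum_norm_sq_apply_le A hv) (by positivity))

/-- A frame optimal for C is a competitor for both A and B. -/
lemma topSum_convex {A B C : Matrix (Fin n) (Fin n) ℂ} (hA : A.IsHermitian) (hB : B.IsHermitian)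
    (hC : C.IsHermitian) (hk : k ≤ n) {a b : ℝ} (ha : 0 ≤ a) (hb : 0 ≤ b)
    (h : C = (a : ℂ) • A + (b : ℂ) • B) :
    topSum hC k ≤ a * topSum hA k + b * topSum hB k := by
  obtain ⟨v, hv, hvC⟩ := exists_frameSum_eq_topSum hC hk
  rw [← hvC, h, frameSum_add, frameSum_smul, frameSum_smul]
  gcongr
  · exact frameSum_le_topSum hA hk hv
  · exact frameSum_le_topSum hB hk hv

lemma topSum_sub_le {A B : Matrix (Fin n) (Fin n) ℂ} (hA : A.IsHermitian) (hB : B.IsHermitian)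
    (hk : k ≤ n) :
    topSum hA k - topSum hB k ≤ √k * √(∑ r, ∑ s, ‖(A - B) r s‖ ^ 2) := by
  obtain ⟨v, hv, hvA⟩ := exists_frameSum_eq_topSum hA hk
  have h1 : frameSum A v = frameSum (A - B) v + frameSum B v := by
    rw [← frameSum_add, sub_add_cancel]
  have h2 := frameSum_le_topSum hB hk hv
  have h3 := frameSum_le_sqrt (A - B) hv
  linarith

end KyFan

/-! ### Partial infima and infimal convolution of convex functions. -/

/-- If `g ≥ 0` is jointly convex, its partial infimum is convex. -/
lemma convexOn_iInf {E U : Type*} [AddCommGroup E] [Module ℝ E] [AddCommGroup U] [Module ℝ U]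
    {g : E → U → ℝ} (hg0 : ∀ x u, 0 ≤ g x u)
    (hg : ∀ x y u v (a b : ℝ), 0 ≤ a → 0 ≤ b → a + b = 1 →
      g (a • x + b • y) (a • u + b • v) ≤ a * g x u + b * g y v) :
    ConvexOn ℝ Set.univ (fun x => ⨅ u, g x u) := by
  have hbdd : ∀ x, BddBelow (Set.range (g x)) := fun x => ⟨0, by rintro _ ⟨u, rfl⟩; exact hg0 x u⟩
  refine ⟨convex_univ, fun x _ y _ a b ha hb hab => ?_⟩
  simp only [smul_eq_mul]
  rw [Real.mul_iInf_of_nonneg ha, Real.mul_iInf_of_nonneg hb]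
  exact le_ciInf_add_ciInf fun u v => (ciInf_le (hbdd _) _).trans (hg x y u v a b ha hb hab)

lemma ConvexOn.measurable_of_finiteDimensional {E : Type*} [NormedAddCommGroup E] [NormedSpace ℝ E]
    [FiniteDimensional ℝ E] [MeasurableSpace E] [BorelSpace E] {f : E → ℝ}
    (hf : ConvexOn ℝ Set.univ f) : Measurable f :=
  hf.locallyLipschitz.continuous.measurable

/-- The infimal convolution of `f` with the cost `c`. -/
noncomputable def infConv {E : Type*} [AddCommGroup E] (c f : E → ℝ) (x : E) : ℝ :=
  ⨅ u, f u + c (x - u)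

section InfConv

variable {E : Type*} [AddCommGroup E] {c f : E → ℝ}

lemma infConv_le (hc : ∀ x, 0 ≤ c x) (hf : ∀ x, 0 ≤ f x) (x u : E) :
    infConv c f x ≤ f u + c (x - u) :=
  ciInf_le ⟨0, by rintro _ ⟨u, rfl⟩; exact add_nonneg (hf u) (hc _)⟩ u

lemma infConv_nonneg (hc : ∀ x, 0 ≤ c x) (hf : ∀ x, 0 ≤ f x) (x : E) : 0 ≤ infConv c f x :=
  le_ciInf fun u => add_nonneg (hf u) (hc _)

lemma convexOn_infConv [Module ℝ E] (hc : ∀ x, 0 ≤ c x) (hcc : ConvexOn ℝ Set.univ c)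
    (hf : ∀ x, 0 ≤ f x) (hfc : ConvexOn ℝ Set.univ f) :
    ConvexOn ℝ Set.univ (infConv c f) := by
  refine convexOn_iInf (fun x u => add_nonneg (hf u) (hc _)) fun x y u v a b ha hb hab => ?_
  have h1 := hfc.2 (Set.mem_univ u) (Set.mem_univ v) ha hb hab
  have h2 := hcc.2 (Set.mem_univ (x - u)) (Set.mem_univ (y - v)) ha hb hab
  rw [show a • x + b • y - (a • u + b • v) = a • (x - u) + b • (y - v) by
    rw [smul_sub, smul_sub]; abel]
  simp only [smul_eq_mul] at h1 h2
  linarith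

end InfConv

/-! ### Maurey's convex property (τ): bounded sets, linear images, products. -/

/-- The convex property `(τ)` of Maurey for the measure `ν` and the cost function `c`. -/
def ConvexTau {E : Type*} [AddCommGroup E] [Module ℝ E] [MeasurableSpace E] (ν : Measure E)
    (c : E → ℝ) : Prop :=
  ∀ f : E → ℝ, (∀ x, 0 ≤ f x) → ConvexOn ℝ Set.univ f →
    (∫⁻ x, ENNReal.ofReal (Real.exp (infConv c f x)) ∂ν) *
      (∫⁻ x, ENNReal.ofReal (Real.exp (-f x)) ∂ν) ≤ 1

lemma exp_sub_sq_le {u : ℝ} (h0 : 0 ≤ u) (h1 : u ≤ 1 / 2) :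
    Real.exp (u - u ^ 2) ≤ 2 - Real.exp (-u) := by
  have hv0 : 0 ≤ u - u ^ 2 := by nlinarith
  have hv1 : u - u ^ 2 ≤ u := by nlinarith
  have hA : Real.exp (u - u ^ 2) ≤
      1 + (u - u ^ 2) + (u - u ^ 2) ^ 2 / 2 + (u - u ^ 2) ^ 3 * (2 / 9) := by
    have := Real.exp_bound' hv0 (by linarith) (n := 3) (by norm_num)
    norm_num [Finset.sum_range_succ, Nat.factorial] at this
    linarith
  -- This follows from exp u ≥ 1 + u + u²/2, because (1 - u + u²/2)(1 + u + u²/2) = 1 + u⁴/4 ≥ 1.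
  have hB : Real.exp (-u) ≤ 1 - u + u ^ 2 / 2 := by
    rw [Real.exp_neg, inv_le_comm₀ (Real.exp_pos u) (by nlinarith)]
    refine le_trans ?_ (Real.quadratic_le_exp_of_nonneg h0)
    rw [inv_le_iff_one_le_mul₀ (by nlinarith)]
    nlinarith [sq_nonneg (u ^ 2)]
  have hC : (u - u ^ 2) ^ 3 ≤ u ^ 3 := pow_le_pow_left₀ hv0 hv1 3
  have hD : u ^ 4 ≤ u ^ 3 / 2 := by
    have : 0 ≤ u ^ 3 := by positivity
    nlinarith
  have : 0 ≤ u ^ 3 := by positivity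
  nlinarith

/-- The optimization behind the property `(τ)` on sets of bounded diameter. -/
lemma exp_le_two_sub_exp {q u : ℝ} (hu : 0 ≤ u)
    (hq : ∀ θ : ℝ, 0 ≤ θ → θ ≤ 1 → q ≤ (1 - θ) * u + θ ^ 2 / 4) :
    Real.exp q ≤ 2 - Real.exp (-u) := by
  rcases le_total u (1 / 2) with h | h
  · refine le_trans (Real.exp_le_exp.2 ?_) (exp_sub_sq_le hu h)
    -- θ = 2u minimizes (1 - θ)u + θ²/4, with value u - u². For u ≥ 1/2 the constrained minimizer is
    -- θ = 1, and the case u = 1/2 suffices because 2 - exp(-u) increases with u.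
    have := hq (2 * u) (by linarith) (by linarith)
    nlinarith
  · have h1 := exp_sub_sq_le (u := 1 / 2) (by norm_num) le_rfl
    have h2 : Real.exp q ≤ Real.exp (1 / 2 - (1 / 2) ^ 2) := by
      have := hq 1 (by norm_num) le_rfl
      exact Real.exp_le_exp.2 (by linarith)
    have h3 : Real.exp (-u) ≤ Real.exp (-(1 / 2)) := Real.exp_le_exp.2 (by linarith)
    linarith

lemma ENNReal.mul_le_one_of_add_le_two {x y : ENNReal} (h : x + y ≤ 2) : x * y ≤ 1 := by
  have hx : x ≠ ⊤ := fun hx => by simp [hx] at h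
  have hy : y ≠ ⊤ := fun hy => by simp [hy] at h
  lift x to NNReal using hx
  lift y to NNReal using hy
  norm_cast at h ⊢
  have h' : (x : ℝ) + y ≤ 2 := by exact_mod_cast h
  have : (x : ℝ) * y ≤ 1 := by nlinarith [sq_nonneg ((x : ℝ) - y), x.2, y.2]
  exact_mod_cast this

lemma convexOn_sq_norm_div {E : Type*} [NormedAddCommGroup E] [NormedSpace ℝ E] (r : ℝ)
    (hr : 0 ≤ r) : ConvexOn ℝ Set.univ (fun x : E => ‖x‖ ^ 2 / r) := by
  have h := (convexOn_norm (E := E) convex_univ).pow (fun x _ => norm_nonneg x) 2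
  simpa [div_eq_inv_mul] using h.smul (inv_nonneg.2 hr)

section Tau

variable {E F : Type*} [NormedAddCommGroup E] [NormedSpace ℝ E] [FiniteDimensional ℝ E]
  [MeasurableSpace E] [BorelSpace E] [NormedAddCommGroup F] [NormedSpace ℝ F]
  [FiniteDimensional ℝ F] [MeasurableSpace F] [BorelSpace F]

/-- Maurey: a probability measure supported in a set of diameter at most `d` has the convex
property `(τ)` with cost `‖x‖² / (4 d²)`. -/
lemma convexTau_of_diam (ν : Measure E) [IsProbabilityMeasure ν] {d : ℝ} (hd : 0 < d) {S : Set E}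
    (hS : ∀ x ∈ S, ∀ y ∈ S, ‖x - y‖ ≤ d) (hν : ∀ᵐ x ∂ν, x ∈ S) :
    ConvexTau ν (fun x => ‖x‖ ^ 2 / (4 * d ^ 2)) := by
  intro f hf hfc
  set c : E → ℝ := fun x => ‖x‖ ^ 2 / (4 * d ^ 2) with hc
  have hc0 : ∀ x, 0 ≤ c x := fun x => by positivity
  have hQm : Measurable (infConv c f) :=
    (convexOn_infConv hc0 (convexOn_sq_norm_div _ (by positivity)) hf
      hfc).measurable_of_finiteDimensional
  have hfm : Measurable f := hfc.measurable_of_finiteDimensional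
  obtain ⟨x₀, hx₀⟩ : S.Nonempty := by
    obtain ⟨x, hx⟩ := hν.exists
    exact ⟨x, hx⟩
  have : Nonempty S := ⟨⟨x₀, hx₀⟩⟩
  set m : ℝ := ⨅ y : S, f y with hm
  have hbdd : BddBelow (Set.range fun y : S => f y) := ⟨0, by rintro _ ⟨y, rfl⟩; exact hf y⟩
  have hmle : ∀ x ∈ S, m ≤ f x := fun x hx => ciInf_le hbdd ⟨x, hx⟩
  have hpt : ∀ x ∈ S, Real.exp (infConv c f x - m) ≤ 2 - Real.exp (-(f x - m)) := by
    intro x hx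
    refine exp_le_two_sub_exp (sub_nonneg.2 (hmle x hx)) fun θ h0 h1 => ?_
    -- The infimal convolution is tested at a point of the segment from x to y, which need not lie
    -- in S; moving a fraction θ of a distance at most d costs at most θ²/4. Taking the infimum over
    -- y then replaces f y by m.
    have hy : ∀ y : S, infConv c f x - (1 - θ) * f x - θ ^ 2 / 4 ≤ θ * f y := by
      rintro ⟨y, hy⟩
      have hle := infConv_le (c := c) hc0 hf x ((1 - θ) • x + θ • y)
      have hcv := hfc.2 (Set.mem_univ x) (Set.mem_univ y) (sub_nonneg.2 h1) h0 (by ring)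
      rw [show x - ((1 - θ) • x + θ • y) = θ • (x - y) by
        rw [smul_sub, sub_smul, one_smul]; abel] at hle
      have hcost : c (θ • (x - y)) ≤ θ ^ 2 / 4 := by
        simp only [hc, norm_smul, Real.norm_of_nonneg h0]
        rw [div_le_div_iff₀ (by positivity) (by norm_num)]
        have : ‖x - y‖ ^ 2 ≤ d ^ 2 := pow_le_pow_left₀ (norm_nonneg _) (hS x hx y hy) 2
        nlinarith [mul_le_mul_of_nonneg_left this (sq_nonneg θ)]
      simp only [smul_eq_mul] at hcv
      linarith
    have := le_ciInf hy
    rw [← Real.mul_iInf_of_nonneg h0, ← hm] at this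
    linarith
  set I := ∫⁻ x, ENNReal.ofReal (Real.exp (infConv c f x - m)) ∂ν with hI
  set J := ∫⁻ x, ENNReal.ofReal (Real.exp (-(f x - m))) ∂ν with hJ
  -- The pointwise bound integrates to I + J ≤ 2, so I * J ≤ 1 by the arithmetic-geometric mean
  -- inequality. The normalizing factors exp m and exp(-m) cancel in the product.
  have hIJ : I + J ≤ 2 := by
    rw [hI, hJ, ← lintegral_add_left (by fun_prop)]
    calc _ ≤ ∫⁻ _, 2 ∂ν := by
          refine lintegral_mono_ae ?_
          filter_upwards [hν] with x hx
          rw [← ENNReal.ofReal_add (Real.exp_pos _).le (Real.exp_pos _).le]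
          refine ENNReal.ofReal_le_of_le_toReal ?_
          simp only [ENNReal.toReal_ofNat]
          linarith [hpt x hx]
      _ = 2 := by simp
  have hIJ1 : I * J ≤ 1 := ENNReal.mul_le_one_of_add_le_two hIJ
  have e1 : ∫⁻ x, ENNReal.ofReal (Real.exp (infConv c f x)) ∂ν
      = ENNReal.ofReal (Real.exp m) * I := by
    rw [hI, ← lintegral_const_mul _ (by fun_prop)]
    refine lintegral_congr fun x => ?_
    rw [← ENNReal.ofReal_mul (Real.exp_pos _).le, ← Real.exp_add]
    congr 2; ring
  have e2 : ∫⁻ x, ENNReal.ofReal (Real.exp (-f x)) ∂ν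
      = ENNReal.ofReal (Real.exp (-m)) * J := by
    rw [hJ, ← lintegral_const_mul _ (by fun_prop)]
    refine lintegral_congr fun x => ?_
    rw [← ENNReal.ofReal_mul (Real.exp_pos _).le, ← Real.exp_add]
    congr 2; ring
  rw [e1, e2, mul_mul_mul_comm, ← ENNReal.ofReal_mul (Real.exp_pos _).le, ← Real.exp_add]
  simpa using hIJ1

/-- Restricting the infimum to the image of T shows that the infimal convolution of f at T x is at
most that of f ∘ T at x. -/
lemma ConvexTau.map {ν : Measure E} {c : E → ℝ} {c' : F → ℝ} (h : ConvexTau ν c)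
    (hc' : ∀ x, 0 ≤ c' x) (hcc' : ConvexOn ℝ Set.univ c')
    (T : E →ₗ[ℝ] F) (hT : ∀ x, c' (T x) ≤ c x) :
    ConvexTau (ν.map T) c' := by
  intro f hf hfc
  have hTm : Measurable T := T.continuous_of_finiteDimensional.measurable
  have hQm : Measurable (infConv c' f) :=
    (convexOn_infConv hc' hcc' hf hfc).measurable_of_finiteDimensional
  have hfm : Measurable f := hfc.measurable_of_finiteDimensional
  rw [lintegral_map (by fun_prop) hTm, lintegral_map (by fun_prop) hTm]
  refine le_trans (mul_le_mul_left (lintegral_mono fun x => ?_) _)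
    (h (fun x => f (T x)) (fun x => hf _) (by simpa using! hfc.comp_linearMap T))
  refine ENNReal.ofReal_le_ofReal (Real.exp_le_exp.2 (le_ciInf fun u => ?_))
  refine (infConv_le hc' hf (T x) (T u)).trans ?_
  rw [← map_sub]
  gcongr
  exact hT _

lemma ofReal_exp_rpow (x : ℝ) {a : ℝ} (ha : 0 ≤ a) :
    ENNReal.ofReal (Real.exp x) ^ a = ENNReal.ofReal (Real.exp (a * x)) := by
  rw [ENNReal.ofReal_rpow_of_nonneg (Real.exp_pos _).le ha, ← Real.exp_mul, mul_comm]

/-- The property `(τ)` tensorizes. -/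
lemma ConvexTau.prod {ν : Measure E} {ρ : Measure F} [IsProbabilityMeasure ν]
    [IsProbabilityMeasure ρ] {c₁ : E → ℝ} {c₂ : F → ℝ} (h₁ : ConvexTau ν c₁) (h₂ : ConvexTau ρ c₂)
    (hc₁ : ∀ x, 0 ≤ c₁ x) (hcc₁ : ConvexOn ℝ Set.univ c₁)
    (hc₂ : ∀ x, 0 ≤ c₂ x) (hcc₂ : ConvexOn ℝ Set.univ c₂) :
    ConvexTau (ν.prod ρ) (fun p => c₁ p.1 + c₂ p.2) := by
  intro f hf hfc
  set c : E × F → ℝ := fun p => c₁ p.1 + c₂ p.2 with hc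
  have hc0 : ∀ p, 0 ≤ c p := fun p => add_nonneg (hc₁ _) (hc₂ _)
  have hcc : ConvexOn ℝ Set.univ c :=
    (hcc₁.comp_linearMap (LinearMap.fst ℝ E F)).add (hcc₂.comp_linearMap (LinearMap.snd ℝ E F))
  have hQm : Measurable (infConv c f) :=
    (convexOn_infConv hc0 hcc hf hfc).measurable_of_finiteDimensional
  have hfm : Measurable f := hfc.measurable_of_finiteDimensional
  have hf2 : ∀ x, ConvexOn ℝ Set.univ (fun y => f (x, y)) := by
    intro x
    refine ⟨convex_univ, fun y _ z _ a b ha hb hab => ?_⟩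
    have := hfc.2 (Set.mem_univ (x, y)) (Set.mem_univ (x, z)) ha hb hab
    rwa [Prod.smul_mk, Prod.smul_mk, Prod.mk_add_mk, ← add_smul, hab, one_smul] at this
  -- Infimal convolution in the second variable only. Property (τ) for ρ is applied on each fibre,
  -- and property (τ) for ν is then applied to φ = log ∫ exp P(x, ·) dρ.
  set P : E × F → ℝ := fun p => infConv c₂ (fun v => f (p.1, v)) p.2 with hP
  have hPc : ConvexOn ℝ Set.univ P := by
    refine convexOn_iInf (g := fun (p : E × F) v => f (p.1, v) + c₂ (p.2 - v))
      (fun p v => add_nonneg (hf _) (hc₂ _)) fun p q u v a b ha hb hab => ?_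
    have e1 := hfc.2 (Set.mem_univ (p.1, u)) (Set.mem_univ (q.1, v)) ha hb hab
    have e2 := hcc₂.2 (Set.mem_univ (p.2 - u)) (Set.mem_univ (q.2 - v)) ha hb hab
    rw [Prod.smul_mk, Prod.smul_mk, Prod.mk_add_mk] at e1
    simp only [smul_eq_mul] at e1 e2
    simp only [Prod.fst_add, Prod.snd_add, Prod.smul_fst, Prod.smul_snd]
    rw [show a • p.2 + b • q.2 - (a • u + b • v) = a • (p.2 - u) + b • (q.2 - v) by
      rw [smul_sub, smul_sub]; abel]
    linarith
  have hPm : Measurable P := hPc.measurable_of_finiteDimensional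
  have hP0 : ∀ p, 0 ≤ P p := fun p => infConv_nonneg hc₂ (fun v => hf _) _
  have hIJ : ∀ x, (∫⁻ y, ENNReal.ofReal (Real.exp (P (x, y))) ∂ρ) *
      (∫⁻ y, ENNReal.ofReal (Real.exp (-f (x, y))) ∂ρ) ≤ 1 :=
    fun x => h₂ (fun v => f (x, v)) (fun v => hf _) (hf2 x)
  set I : E → ENNReal := fun x => ∫⁻ y, ENNReal.ofReal (Real.exp (P (x, y))) ∂ρ with hI
  set J : E → ENNReal := fun x => ∫⁻ y, ENNReal.ofReal (Real.exp (-f (x, y))) ∂ρ with hJ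
  replace hIJ : ∀ x, I x * J x ≤ 1 := hIJ
  -- Since J is nonzero, I * J ≤ 1 forces I to be finite, so its logarithm is meaningful.
  have hJ0 : ∀ x, J x ≠ 0 := by
    intro x h0
    have hm : Measurable fun y => ENNReal.ofReal (Real.exp (-f (x, y))) := by fun_prop
    rw [hJ, lintegral_eq_zero_iff hm] at h0
    obtain ⟨y, hy⟩ := h0.exists
    simp only [Pi.zero_apply, ENNReal.ofReal_eq_zero] at hy
    exact absurd hy (not_le.2 (Real.exp_pos _))
  have hIt : ∀ x, I x ≠ ⊤ := by
    intro x h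
    have := hIJ x
    simp [h, ENNReal.top_mul (hJ0 x)] at this
  have hI1 : ∀ x, 1 ≤ I x := by
    intro x
    calc (1 : ENNReal) = ∫⁻ _, 1 ∂ρ := by simp
      _ ≤ I x := lintegral_mono fun y => by
          rw [ENNReal.one_le_ofReal]
          exact Real.one_le_exp (hP0 _)
  have hI1' : ∀ x, 1 ≤ (I x).toReal := fun x => by
    simpa using ENNReal.toReal_mono (hIt x) (hI1 x)
  set φ : E → ℝ := fun x => Real.log (I x).toReal with hφ
  have hexpφ : ∀ x, ENNReal.ofReal (Real.exp (φ x)) = I x := fun x => by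
    rw [hφ, Real.exp_log (by linarith [hI1' x]), ENNReal.ofReal_toReal (hIt x)]
  have hφ0 : ∀ x, 0 ≤ φ x := fun x => Real.log_nonneg (hI1' x)
  have hφle : ∀ x r, I x ≤ ENNReal.ofReal (Real.exp r) → φ x ≤ r := by
    intro x r h
    rw [← hexpφ, ENNReal.ofReal_le_ofReal_iff (Real.exp_pos _).le] at h
    exact Real.exp_le_exp.1 h
  -- P is jointly convex, so Hölder's inequality with exponents 1/a and 1/b makes the logarithm of
  -- the integral of exp P convex in x.
  have hφc : ConvexOn ℝ Set.univ φ := by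
    refine ⟨convex_univ, fun x _ y _ a b ha hb hab => hφle _ _ ?_⟩
    have hmx : ∀ x, Measurable fun v => ENNReal.ofReal (Real.exp (P (x, v))) := fun x => by fun_prop
    calc I (a • x + b • y)
        ≤ ∫⁻ v, ENNReal.ofReal (Real.exp (P (x, v))) ^ a *
            ENNReal.ofReal (Real.exp (P (y, v))) ^ b ∂ρ := by
          refine lintegral_mono fun v => ?_
          rw [ofReal_exp_rpow _ ha, ofReal_exp_rpow _ hb, ← ENNReal.ofReal_mul (Real.exp_pos _).le,
            ← Real.exp_add]
          refine ENNReal.ofReal_le_ofReal (Real.exp_le_exp.2 ?_)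
          have := hPc.2 (Set.mem_univ (x, v)) (Set.mem_univ (y, v)) ha hb hab
          rwa [Prod.smul_mk, Prod.smul_mk, Prod.mk_add_mk, ← add_smul a b v, hab, one_smul] at this
      _ ≤ I x ^ a * I y ^ b :=
          ENNReal.lintegral_mul_norm_pow_le (hmx x).aemeasurable (hmx y).aemeasurable ha hb hab
      _ = ENNReal.ofReal (Real.exp (a • φ x + b • φ y)) := by
          rw [← hexpφ x, ← hexpφ y, ofReal_exp_rpow _ ha, ofReal_exp_rpow _ hb,
            ← ENNReal.ofReal_mul (Real.exp_pos _).le, ← Real.exp_add]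
          simp
  have hmain := h₁ φ hφ0 hφc
  refine le_trans (mul_le_mul' ?_ ?_) hmain
  · rw [lintegral_prod _ (by fun_prop)]
    refine lintegral_mono fun x => ?_
    set A := ∫⁻ y, ENNReal.ofReal (Real.exp (infConv c f (x, y))) ∂ρ with hA
    -- The full infimal convolution at (x, y) is at most P(x', y) + c₁(x - x') for every x'.
    -- Integrating in y and then minimizing over x' yields the infimal convolution of φ.
    have hAle : ∀ x', A ≤ ENNReal.ofReal (Real.exp (φ x' + c₁ (x - x'))) := by
      intro x'
      rw [Real.exp_add, ENNReal.ofReal_mul (Real.exp_pos _).le, hexpφ, mul_comm, hI,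
        ← lintegral_const_mul _ (by fun_prop)]
      refine lintegral_mono fun y => ?_
      rw [← ENNReal.ofReal_mul (Real.exp_pos _).le, ← Real.exp_add]
      refine ENNReal.ofReal_le_ofReal (Real.exp_le_exp.2 ?_)
      rw [← sub_le_iff_le_add']
      refine le_ciInf fun v => ?_
      have := infConv_le hc0 hf (x, y) (x', v)
      simp only [hc, Prod.mk_sub_mk] at this ⊢
      linarith
    have hAt : A ≠ ⊤ := ne_top_of_le_ne_top ENNReal.ofReal_ne_top (hAle x)
    rcases eq_or_ne A 0 with h0 | h0
    · rw [h0]; exact zero_le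
    have hpos : 0 < A.toReal := ENNReal.toReal_pos h0 hAt
    rw [← ENNReal.ofReal_toReal hAt, ← Real.exp_log hpos]
    refine ENNReal.ofReal_le_ofReal (Real.exp_le_exp.2 (le_ciInf fun x' => ?_))
    rw [Real.log_le_iff_le_exp hpos]
    exact ENNReal.toReal_le_of_le_ofReal (Real.exp_pos _).le (hAle x')
  · rw [lintegral_prod _ (by fun_prop)]
    refine lintegral_mono fun x => ?_
    rw [Real.exp_neg, ENNReal.ofReal_inv_of_pos (Real.exp_pos _), hexpφ]
    exact ENNReal.le_inv_iff_mul_le.2 (by rw [mul_comm]; exact hIJ x)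

end Tau

lemma convexOn_sum_apply {ι E : Type*} [Fintype ι] [AddCommGroup E] [Module ℝ E] {c : ι → E → ℝ}
    (hcc : ∀ i, ConvexOn ℝ Set.univ (c i)) :
    ConvexOn ℝ Set.univ (fun z : ι → E => ∑ i, c i (z i)) := by
  refine ⟨convex_univ, fun x _ y _ a b ha hb hab => ?_⟩
  simp only [smul_eq_mul, Finset.mul_sum, ← Finset.sum_add_distrib]
  exact Finset.sum_le_sum fun i _ => (hcc i).2 (Set.mem_univ _) (Set.mem_univ _) ha hb hab

lemma ofReal_mul_measureReal_le_lintegral {E : Type*} [MeasurableSpace E] {ν : Measure E} [IsFiniteMeasure ν] {s : Set E}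
    (hs : MeasurableSet s) {g : E → ENNReal} {r : ℝ} (hr : 0 ≤ r)
    (h : ∀ x ∈ s, ENNReal.ofReal r ≤ g x) :
    ENNReal.ofReal (r * ν.real s) ≤ ∫⁻ x, g x ∂ν := by
  calc ENNReal.ofReal (r * ν.real s) = ENNReal.ofReal r * ν s := by
        rw [ENNReal.ofReal_mul hr, ofReal_measureReal]
    _ = ∫⁻ _ in s, ENNReal.ofReal r ∂ν := by simp
    _ ≤ ∫⁻ x in s, g x ∂ν := setLIntegral_mono_ae' hs (ae_of_all _ h)
    _ ≤ ∫⁻ x, g x ∂ν := setLIntegral_le_lintegral _ _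

section Pi

variable {E : Type*} [NormedAddCommGroup E] [NormedSpace ℝ E] [FiniteDimensional ℝ E]
  [MeasurableSpace E] [BorelSpace E]

/-- Induction on m: the product law is the image of ν 0 times the remaining product under the linear
map `Fin.cons`, which preserves the total cost. -/
lemma ConvexTau.pi_fin {m : ℕ} (ν : Fin m → Measure E) [∀ i, IsProbabilityMeasure (ν i)]
    {c : Fin m → E → ℝ} (hc : ∀ i x, 0 ≤ c i x) (hcc : ∀ i, ConvexOn ℝ Set.univ (c i))
    (h : ∀ i, ConvexTau (ν i) (c i)) :
    ConvexTau (Measure.pi ν) (fun z => ∑ i, c i (z i)) := by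
  induction m with
  | zero =>
    intro f hf _
    have h1 : ∀ x, infConv (fun z : Fin 0 → E => ∑ i, c i (z i)) f x ≤ f default := fun x => by
      simpa using infConv_le (c := fun z : Fin 0 → E => ∑ i, c i (z i)) (by simp) hf x default
    calc _ ≤ (∫⁻ _, ENNReal.ofReal (Real.exp (f default)) ∂Measure.pi ν) *
          ∫⁻ _, ENNReal.ofReal (Real.exp (-f default)) ∂Measure.pi ν := by
          gcongr with x x
          · exact h1 x
          · rw [Subsingleton.elim x default]
      _ = 1 := by
          simp only [lintegral_const, measure_univ, mul_one]
          rw [← ENNReal.ofReal_mul (Real.exp_pos _).le, ← Real.exp_add]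
          simp
  | succ m ih =>
    have hprod := (h 0).prod (ih (fun i => ν i.succ) (fun i => hc i.succ) (fun i => hcc i.succ)
      (fun i => h i.succ)) (hc 0) (hcc 0) (fun z => Finset.sum_nonneg fun i _ => hc _ _)
      (convexOn_sum_apply fun i => hcc i.succ)
    let T : E × (Fin m → E) →ₗ[ℝ] (Fin (m + 1) → E) :=
      { toFun := fun p => Fin.cons p.1 p.2
        map_add' := fun p q => by
          ext i; refine Fin.cases ?_ (fun j => ?_) i <;> simp
        map_smul' := fun a p => by
          ext i; refine Fin.cases ?_ (fun j => ?_) i <;> simp }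
    have hmap : ((ν 0).prod (Measure.pi fun i : Fin m => ν i.succ)).map T = Measure.pi ν := by
      have := ((measurePreserving_piFinSuccAbove ν 0).symm).map_eq
      simp only [Fin.succAbove_zero] at this
      rw [← this]
      congr 1
      funext p
      exact (Fin.insertNth_zero' p.1 p.2).symm
    rw [← hmap]
    exact hprod.map (fun z => Finset.sum_nonneg fun i _ => hc _ _) (convexOn_sum_apply hcc) T
      (fun p => by simp [T, Fin.sum_univ_succ])

lemma ConvexTau.pi {ι : Type*} [Fintype ι] (ν : ι → Measure E) [∀ i, IsProbabilityMeasure (ν i)]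
    {c : ι → E → ℝ} (hc : ∀ i x, 0 ≤ c i x) (hcc : ∀ i, ConvexOn ℝ Set.univ (c i))
    (h : ∀ i, ConvexTau (ν i) (c i)) :
    ConvexTau (Measure.pi ν) (fun z => ∑ i, c i (z i)) := by
  let e := (Fintype.equivFin ι).symm
  have hfin := ConvexTau.pi_fin (fun i => ν (e i)) (fun i => hc (e i)) (fun i => hcc (e i))
    (fun i => h (e i))
  have hmap := Measure.pi_map_piCongrLeft e ν
  have hT : ∀ z : Fin (Fintype.card ι) → E,
      MeasurableEquiv.piCongrLeft (fun _ : ι => E) e z = LinearMap.funLeft ℝ E e.symm z := by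
    intro z
    ext i
    obtain ⟨j, rfl⟩ := e.surjective i
    rw [MeasurableEquiv.coe_piCongrLeft, Equiv.piCongrLeft_apply_apply]
    simp [LinearMap.funLeft_apply]
  rw [← hmap, funext hT]
  refine hfin.map (fun z => Finset.sum_nonneg fun i _ => hc _ _) (convexOn_sum_apply hcc) _
    (fun z => le_of_eq ?_)
  rw [← e.sum_comp]
  simp [LinearMap.funLeft_apply]

end Pi

/-! ### From property (τ) to deviation inequalities, and existence of medians. -/

section Deviation

variable {E : Type*} [NormedAddCommGroup E] [NormedSpace ℝ E] [FiniteDimensional ℝ E]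
  [MeasurableSpace E] [BorelSpace E]

/-- The product of the probabilities of two level sets of a convex function at distance `t`. -/
lemma ConvexTau.measureReal_mul_le {ν : Measure E} [IsProbabilityMeasure ν] {c : E → ℝ}
    (h : ConvexTau ν c) (hc : ∀ x, 0 ≤ c x) {G : E → ℝ} (hG : ConvexOn ℝ Set.univ G)
    {L : ℝ} (hL : 0 < L) (hGL : ∀ x y, G x - G y ≤ L * √(c (x - y))) (a : ℝ) {t : ℝ} (ht : 0 < t) :
    ν.real {x | G x ≤ a} * ν.real {x | a + t ≤ G x} ≤ Real.exp (-(t / L) ^ 2) := by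
  have hGm : Measurable G := hG.measurable_of_finiteDimensional
  -- This slope maximizes over K the minimum over r of K(t - Lr) + r²; the minimum is then (t/L)²,
  -- at r = t/L.
  set K := 2 * t / L ^ 2 with hK
  have hK0 : 0 ≤ K := by positivity
  set f : E → ℝ := fun x => K * max (G x - a) 0 with hf
  have hf0 : ∀ x, 0 ≤ f x := fun x => by positivity
  have hfc : ConvexOn ℝ Set.univ f := by
    have h1 : ConvexOn ℝ Set.univ (fun x => G x - a) := hG.sub (concaveOn_const a convex_univ)
    have h2 := (h1.sup (convexOn_const (0 : ℝ) convex_univ)).smul hK0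
    exact h2
  have hτ := h f hf0 hfc
  have h1 : ENNReal.ofReal (Real.exp ((t / L) ^ 2) * ν.real {x | a + t ≤ G x}) ≤
      ∫⁻ x, ENNReal.ofReal (Real.exp (infConv c f x)) ∂ν := by
    refine ofReal_mul_measureReal_le_lintegral (measurableSet_le measurable_const hGm)
      (Real.exp_pos _).le fun x hx => ENNReal.ofReal_le_ofReal (Real.exp_le_exp.2 ?_)
    refine le_ciInf fun u => ?_
    set r := √(c (x - u)) with hr
    have hcr : c (x - u) = r ^ 2 := (Real.sq_sqrt (hc _)).symm
    have h3 : K * (t - L * r) ≤ f u := by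
      refine mul_le_mul_of_nonneg_left ?_ hK0
      have := hGL x u
      have hx' : a + t ≤ G x := hx
      exact le_max_of_le_left (by linarith)
    have h4 : K * (t - L * r) + r ^ 2 = (t / L) ^ 2 + (r - t / L) ^ 2 := by
      rw [hK]; field_simp; ring
    rw [hcr]
    nlinarith [sq_nonneg (r - t / L)]
  have h2 : ENNReal.ofReal (1 * ν.real {x | G x ≤ a}) ≤
      ∫⁻ x, ENNReal.ofReal (Real.exp (-f x)) ∂ν := by
    refine ofReal_mul_measureReal_le_lintegral (measurableSet_le hGm measurable_const)
      zero_le_one fun x hx => ENNReal.ofReal_le_ofReal ?_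
    have hx' : G x ≤ a := hx
    have : f x = 0 := by
      simp only [hf]
      rw [max_eq_right (by linarith), mul_zero]
    rw [this]; simp
  have h3 := (mul_le_mul' h1 h2).trans hτ
  rw [← ENNReal.ofReal_mul (by positivity), ENNReal.ofReal_le_one] at h3
  rw [Real.exp_neg, ← one_div, le_div_iff₀ (Real.exp_pos _)]
  linarith

/-- Concentration of a convex function around its medians. -/
lemma ConvexTau.measureReal_le_of_isMedian {Ω : Type*} [MeasurableSpace Ω] {μ : Measure Ω}
    [IsProbabilityMeasure μ] {Z : Ω → E} (hZ : Measurable Z) {c : E → ℝ}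
    (h : ConvexTau (μ.map Z) c) (hc : ∀ x, 0 ≤ c x) {G : E → ℝ} (hG : ConvexOn ℝ Set.univ G)
    {L : ℝ} (hL : 0 < L) (hGL : ∀ x y, G x - G y ≤ L * √(c (x - y))) {m : ℝ}
    (hm : IsMedian μ (fun ω => G (Z ω)) m) {t : ℝ} (ht : 0 < t) :
    μ.real {ω | t ≤ |G (Z ω) - m|} ≤ 4 * Real.exp (-(t / L) ^ 2) := by
  have := Measure.isProbabilityMeasure_map (μ := μ) hZ.aemeasurable
  have hGm : Measurable G := hG.measurable_of_finiteDimensional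
  have e1 : ∀ a, (μ.map Z).real {x | G x ≤ a} = μ.real {ω | G (Z ω) ≤ a} := fun a =>
    map_measureReal_apply hZ (measurableSet_le hGm measurable_const)
  have e2 : ∀ a, (μ.map Z).real {x | a ≤ G x} = μ.real {ω | a ≤ G (Z ω)} := fun a =>
    map_measureReal_apply hZ (measurableSet_le measurable_const hGm)
  -- With a = m and then a = m - t, one factor is at least 1/2 by the median property, so each tail
  -- is at most 2 exp(-(t/L)²).
  have h1 := h.measureReal_mul_le hc hG hL hGL m ht
  have h2 := h.measureReal_mul_le hc hG hL hGL (m - t) ht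
  rw [e1, e2] at h1 h2
  rw [sub_add_cancel] at h2
  have hsub : {ω | t ≤ |G (Z ω) - m|} ⊆ {ω | m + t ≤ G (Z ω)} ∪ {ω | G (Z ω) ≤ m - t} := by
    intro ω hω
    rcases le_abs.1 (show t ≤ |G (Z ω) - m| from hω) with h | h
    · exact Or.inl (show m + t ≤ G (Z ω) by linarith)
    · exact Or.inr (show G (Z ω) ≤ m - t by linarith)
  refine ((measureReal_mono hsub).trans (measureReal_union_le _ _)).trans ?_
  have h3 : (0 : ℝ) ≤ μ.real {ω | m + t ≤ G (Z ω)} := measureReal_nonneg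
  have h4 : (0 : ℝ) ≤ μ.real {ω | G (Z ω) ≤ m - t} := measureReal_nonneg
  have hm1 := hm.1
  have hm2 := hm.2
  nlinarith

end Deviation

/-- The median is the infimum of the points where the distribution function is at least 1/2. Right
continuity gives one inequality; exhausting {Y < m} by the sets {Y ≤ m - 1/(n+1)} gives the other.
-/
lemma exists_isMedian {Ω : Type*} [MeasurableSpace Ω] (μ : Measure Ω) [IsProbabilityMeasure μ]
    {Y : Ω → ℝ} (hY : Measurable Y) : ∃ m, IsMedian μ Y m := by
  have := Measure.isProbabilityMeasure_map (μ := μ) hY.aemeasurable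
  set F := cdf (μ.map Y) with hF
  have hFY : ∀ x, F x = μ.real {ω | Y ω ≤ x} := fun x => by
    rw [hF, cdf_eq_real, map_measureReal_apply hY measurableSet_Iic]; rfl
  set S := {x | 1 / 2 ≤ F x} with hS
  have hne : S.Nonempty := by
    obtain ⟨x, hx⟩ := ((tendsto_cdf_atTop (μ.map Y)).eventually
      (eventually_ge_nhds (by norm_num : (1 / 2 : ℝ) < 1))).exists
    exact ⟨x, hx⟩
  have hbdd : BddBelow S := by
    obtain ⟨x, hx⟩ := ((tendsto_cdf_atBot (μ.map Y)).eventually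
      (eventually_lt_nhds (by norm_num : (0 : ℝ) < 1 / 2))).exists
    refine ⟨x, fun y hy => le_of_lt ?_⟩
    by_contra hxy
    exact absurd (hy.trans (F.mono (not_lt.1 hxy))) (not_le.2 hx)
  refine ⟨sInf S, ?_, ?_⟩
  · rw [← hFY, ← F.iInf_Ioi_eq (sInf S)]
    refine le_ciInf fun ⟨r, hr⟩ => ?_
    obtain ⟨y, hy, hyr⟩ := exists_lt_of_csInf_lt hne hr
    exact le_trans hy (F.mono hyr.le)
  · have hlt : μ.real {ω | Y ω < sInf S} ≤ 1 / 2 := by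
      have hU : {ω | Y ω < sInf S} = ⋃ n : ℕ, {ω | Y ω ≤ sInf S - 1 / ((n : ℝ) + 1)} := by
        ext ω
        simp only [Set.mem_ofPred_eq, Set.mem_iUnion]
        constructor
        · intro h
          obtain ⟨n, hn⟩ := exists_nat_one_div_lt (sub_pos.2 h)
          exact ⟨n, by linarith⟩
        · rintro ⟨n, hn⟩
          have : (0 : ℝ) < 1 / ((n : ℝ) + 1) := by positivity
          linarith
      have hmono : Monotone fun n : ℕ => {ω | Y ω ≤ sInf S - 1 / ((n : ℝ) + 1)} := by
        intro n k hnk ω hω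
        have h1 : 1 / ((k : ℝ) + 1) ≤ 1 / ((n : ℝ) + 1) := by gcongr
        have h2 : Y ω ≤ sInf S - 1 / ((n : ℝ) + 1) := hω
        exact show Y ω ≤ sInf S - 1 / ((k : ℝ) + 1) by linarith
      rw [hU]
      have ht := tendsto_measure_iUnion_atTop (μ := μ) hmono
      refine ENNReal.toReal_le_of_le_ofReal (by norm_num) (le_of_tendsto' ht fun n => ?_)
      rw [Function.comp_apply, ← ofReal_measureReal, ← hFY]
      refine ENNReal.ofReal_le_ofReal (le_of_lt ?_)
      by_contra hcon
      have h1 : sInf S ≤ sInf S - 1 / ((n : ℝ) + 1) := csInf_le hbdd (not_lt.1 hcon)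
      have : (0 : ℝ) < 1 / ((n : ℝ) + 1) := by positivity
      linarith
    have hcompl : {ω | sInf S ≤ Y ω} = {ω | Y ω < sInf S}ᶜ := by ext; simp
    rw [hcompl, probReal_compl_eq_one_sub (measurableSet_lt hY measurable_const)]
    linarith

/-! ### Property (τ) for the law of a single matrix entry. -/

section Entries

variable {Ω : Type*} [MeasurableSpace Ω] {μ : Measure Ω} [IsProbabilityMeasure μ]

lemma SupportedInDiam.convexTau {Z : Ω → ℂ} (hZ : Measurable Z) {D : ℝ} (hD : 0 < D)
    (h : SupportedInDiam μ Z D) : ConvexTau (μ.map Z) (fun z => ‖z‖ ^ 2 / (4 * D ^ 2)) := by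
  obtain ⟨S, hSb, hSd, hS⟩ := h
  have := Measure.isProbabilityMeasure_map (μ := μ) hZ.aemeasurable
  -- The closure has the same diameter and, unlike S, is known to be measurable.
  refine convexTau_of_diam _ hD (S := closure S) (fun x hx y hy => ?_) ?_
  · rw [← dist_eq_norm]
    refine (Metric.dist_le_diam_of_mem hSb.closure hx hy).trans ?_
    rwa [Metric.diam_closure]
  · exact (ae_map_iff (p := (· ∈ closure S)) hZ.aemeasurable isClosed_closure.measurableSet).2 <|
      hS.mono fun ω hω => subset_closure hω

lemma SupportedInInterval.convexTau {Y : Ω → ℝ} (hY : Measurable Y) {D : ℝ} (hD : 0 < D)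
    (h : SupportedInInterval μ Y D) : ConvexTau (μ.map Y) (fun y => ‖y‖ ^ 2 / (4 * D ^ 2)) := by
  obtain ⟨a, b, hab, hS⟩ := h
  have := Measure.isProbabilityMeasure_map (μ := μ) hY.aemeasurable
  refine convexTau_of_diam _ hD (S := Set.Icc a b) (fun x hx y hy => ?_) ?_
  · rw [Real.norm_eq_abs, abs_le]
    constructor <;> linarith [hx.1, hx.2, hy.1, hy.2]
  · exact (ae_map_iff (p := (· ∈ Set.Icc a b)) hY.aemeasurable measurableSet_Icc).2 hS

lemma SupportedInInterval.convexTau_ofReal {Z : Ω → ℂ} (hZ : Measurable Z)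
    (hreal : ∀ ω, ((Z ω).re : ℂ) = Z ω) {D : ℝ} (hD : 0 < D)
    (h : SupportedInInterval μ (fun ω => (Z ω).re) D) :
    ConvexTau (μ.map Z) (fun z => ‖z‖ ^ 2 / (4 * D ^ 2)) := by
  have hre : Measurable fun ω => (Z ω).re := Complex.measurable_re.comp hZ
  have hmap : μ.map Z = (μ.map fun ω => (Z ω).re).map Complex.ofRealCLM.toLinearMap := by
    rw [Measure.map_map (by exact Complex.ofRealCLM.continuous.measurable) hre]
    congr 1
    funext ω
    exact (hreal ω).symm
  rw [hmap]
  exact (h.convexTau hre hD).map (fun x => by positivity) (convexOn_sq_norm_div _ (by positivity)) _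
    (fun x => by simp)

/-- The support may have diameter √2 D, so a direct diameter bound would lose a factor. Tensorizing
over α and β keeps the constant D, and multiplication by w does not increase norms. -/
lemma IsScaledIndepPair.convexTau {Z : Ω → ℂ} {D : ℝ} (hD : 0 < D)
    (h : IsScaledIndepPair μ Z D) : ConvexTau (μ.map Z) (fun z => ‖z‖ ^ 2 / (4 * D ^ 2)) := by
  obtain ⟨w, α, β, hw, hα, hβ, hind, hαD, hβD, hZ⟩ := h
  have := Measure.isProbabilityMeasure_map (μ := μ) hα.aemeasurable
  have := Measure.isProbabilityMeasure_map (μ := μ) hβ.aemeasurable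
  have hprod := (hαD.convexTau hα hD).prod (hβD.convexTau hβ hD) (fun x => by positivity)
    (convexOn_sq_norm_div _ (by positivity)) (fun x => by positivity)
    (convexOn_sq_norm_div _ (by positivity))
  rw [← (indepFun_iff_map_prod_eq_prod_map_map hα.aemeasurable hβ.aemeasurable).1 hind] at hprod
  let T : ℝ × ℝ →ₗ[ℝ] ℂ :=
    { toFun := fun p => w * ((p.1 : ℂ) + Complex.I * (p.2 : ℂ))
      map_add' := fun p q => by simp; ring
      map_smul' := fun a p => by simp; ring }
  have hmap : μ.map Z = (μ.map fun ω => (α ω, β ω)).map T := by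
    rw [Measure.map_map T.continuous_of_finiteDimensional.measurable (hα.prodMk hβ)]
    exact Measure.map_congr hZ
  rw [hmap]
  refine hprod.map (fun x => by positivity) (convexOn_sq_norm_div _ (by positivity)) T fun p => ?_
  have h1 : ‖T p‖ ^ 2 = ‖w‖ ^ 2 * (p.1 ^ 2 + p.2 ^ 2) := by
    change ‖w * ((p.1 : ℂ) + Complex.I * (p.2 : ℂ))‖ ^ 2 = _
    rw [norm_mul, mul_pow, mul_comm Complex.I, ← Complex.normSq_eq_norm_sq (_ + _),
      Complex.normSq_add_mul_I]
  rw [h1, ← add_div, Real.norm_eq_abs, Real.norm_eq_abs, sq_abs, sq_abs]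
  gcongr
  have : ‖w‖ ^ 2 ≤ 1 := pow_le_one₀ (norm_nonneg _) hw
  nlinarith [sq_nonneg p.1, sq_nonneg p.2]

end Entries

/-! ### Self-adjoint matrices parametrized by their upper entries. -/

/-- Pairs of indices on or above the diagonal. -/
abbrev UpperIndex (n : ℕ) : Type := {p : Fin n × Fin n // p.1 ≤ p.2}

section HermOfUpper

variable {n : ℕ}

/-- The self-adjoint matrix with given entries above the diagonal, whose diagonal entries are the
real parts of the given ones. -/
noncomputable def hermOfUpper (z : UpperIndex n → ℂ) : Matrix (Fin n) (Fin n) ℂ :=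
  Matrix.of fun j k =>
    if h : j < k then z ⟨(j, k), h.le⟩
    else if h' : k < j then star (z ⟨(k, j), h'.le⟩)
    else ((z ⟨(j, j), le_rfl⟩).re : ℂ)

lemma hermOfUpper_of_lt (z : UpperIndex n → ℂ) {j k : Fin n} (h : j < k) :
    hermOfUpper z j k = z ⟨(j, k), h.le⟩ := by
  simp [hermOfUpper, h]

lemma hermOfUpper_of_gt (z : UpperIndex n → ℂ) {j k : Fin n} (h : k < j) :
    hermOfUpper z j k = star (z ⟨(k, j), h.le⟩) := by
  simp [hermOfUpper, h, h.not_gt]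

lemma hermOfUpper_diag (z : UpperIndex n → ℂ) (j : Fin n) :
    hermOfUpper z j j = ((z ⟨(j, j), le_rfl⟩).re : ℂ) := by
  simp [hermOfUpper]

lemma isHermitian_hermOfUpper (z : UpperIndex n → ℂ) : (hermOfUpper z).IsHermitian := by
  ext j k
  rw [Matrix.conjTranspose_apply]
  rcases lt_trichotomy j k with h | rfl | h
  · rw [hermOfUpper_of_lt z h, hermOfUpper_of_gt z h, star_star]
  · rw [hermOfUpper_diag]; simp
  · rw [hermOfUpper_of_lt z h, hermOfUpper_of_gt z h]

lemma hermOfUpper_combination (a b : ℝ) (x y : UpperIndex n → ℂ) :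
    hermOfUpper (a • x + b • y) = (a : ℂ) • hermOfUpper x + (b : ℂ) • hermOfUpper y := by
  ext j k
  rw [Matrix.add_apply, Matrix.smul_apply, Matrix.smul_apply]
  rcases lt_trichotomy j k with h | rfl | h
  · simp [hermOfUpper_of_lt _ h]
  · simp [hermOfUpper_diag]
  · simp [hermOfUpper_of_gt _ h]

lemma hermOfUpper_sub (x y : UpperIndex n → ℂ) :
    hermOfUpper (x - y) = hermOfUpper x - hermOfUpper y := by
  simpa [sub_eq_add_neg] using hermOfUpper_combination 1 (-1) x y

lemma hermOfUpper_neg (x : UpperIndex n → ℂ) : hermOfUpper (-x) = -hermOfUpper x := by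
  simpa using hermOfUpper_combination (-1) 0 x 0

lemma hermOfUpper_eq {A : Matrix (Fin n) (Fin n) ℂ} (hA : A.IsHermitian) :
    hermOfUpper (fun p : UpperIndex n => A p.1.1 p.1.2) = A := by
  ext j k
  rcases lt_trichotomy j k with h | rfl | h
  · rw [hermOfUpper_of_lt _ h]
  · rw [hermOfUpper_diag]; exact hA.coe_re_apply_self j
  · rw [hermOfUpper_of_gt _ h]; exact hA.apply j k

/-- The diameter allowed for an entry: `√2 D` on the diagonal, `D` off the diagonal. -/
noncomputable def entryDiam (D : ℝ) (p : UpperIndex n) : ℝ :=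
  if p.1.1 = p.1.2 then √2 * D else D

/-- The quadratic cost of a family of entries. -/
noncomputable def entryCost (D : ℝ) (z : UpperIndex n → ℂ) : ℝ :=
  ∑ p, ‖z p‖ ^ 2 / (4 * entryDiam D p ^ 2)

lemma entryCost_nonneg (D : ℝ) (z : UpperIndex n → ℂ) : 0 ≤ entryCost D z :=
  Finset.sum_nonneg fun p _ => by positivity

lemma convexOn_entryCost (D : ℝ) : ConvexOn ℝ Set.univ (entryCost (n := n) D) :=
  convexOn_sum_apply fun _ => convexOn_sq_norm_div _ (by positivity)

/-- An off-diagonal entry occurs twice and 2|z|² = 8D² · |z|²/(4D²); a diagonal entry occurs once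
and |z|² = 8D² · |z|²/(4(√2 D)²). The diameter √2 D on the diagonal is what makes the two constants
agree. -/
lemma sum_sq_hermOfUpper_le {D : ℝ} (hD : 0 < D) (z : UpperIndex n → ℂ) :
    ∑ r, ∑ s, ‖hermOfUpper z r s‖ ^ 2 ≤ 8 * D ^ 2 * entryCost D z := by
  -- The summands of the cost are extended by zero below the diagonal, so that both sides can be
  -- compared after symmetrizing in r and s.
  set g : Fin n → Fin n → ℝ := fun r s =>
    if h : r ≤ s then 8 * D ^ 2 * (‖z ⟨(r, s), h⟩‖ ^ 2 / (4 * entryDiam D ⟨(r, s), h⟩ ^ 2)) else 0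
    with hg
  have hsum : 8 * D ^ 2 * entryCost D z = ∑ r, ∑ s, g r s := by
    rw [← Fintype.sum_prod_type',
      ← Fintype.sum_subtype_add_sum_subtype (fun p : Fin n × Fin n => p.1 ≤ p.2)]
    rw [Finset.sum_eq_zero (s := (Finset.univ : Finset {p : Fin n × Fin n // ¬p.1 ≤ p.2}))
      (fun p _ => dif_neg p.2), add_zero, entryCost, Finset.mul_sum]
    exact Finset.sum_congr rfl fun p _ => by
      simp only [hg]
      rw [dif_pos p.2]
  have hlt : ∀ r s, r < s →
      ‖hermOfUpper z r s‖ ^ 2 + ‖hermOfUpper z s r‖ ^ 2 ≤ g r s + g s r := by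
    intro r s h
    rw [hermOfUpper_of_lt z h, hermOfUpper_of_gt z h, norm_star]
    simp only [hg, h.le, h.not_ge, dite_true, dite_false, entryDiam, h.ne, if_false]
    refine le_of_eq ?_
    field_simp
    ring
  have hpair : ∀ r s,
      ‖hermOfUpper z r s‖ ^ 2 + ‖hermOfUpper z s r‖ ^ 2 ≤ g r s + g s r := by
    intro r s
    rcases lt_trichotomy r s with h | rfl | h
    · exact hlt r s h
    · have h1 : g r r = ‖z ⟨(r, r), le_rfl⟩‖ ^ 2 := by
        simp only [hg, le_refl, dite_true, entryDiam, if_true, mul_pow,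
          Real.sq_sqrt (zero_le_two (α := ℝ))]
        field_simp
        ring
      rw [h1, hermOfUpper_diag, Complex.norm_real, Real.norm_eq_abs]
      have := pow_le_pow_left₀ (abs_nonneg _) (Complex.abs_re_le_norm (z ⟨(r, r), le_rfl⟩)) 2
      exact add_le_add this this
    · linarith [hlt s r h]
  have h2 := Finset.sum_le_sum fun r (_ : r ∈ Finset.univ) =>
    Finset.sum_le_sum fun s (_ : s ∈ Finset.univ) => hpair r s
  simp only [Finset.sum_add_distrib] at h2
  rw [Finset.sum_comm (f := fun r s => ‖hermOfUpper z s r‖ ^ 2),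
    Finset.sum_comm (f := fun r s => g s r)] at h2
  rw [hsum]
  linarith

lemma convexOn_topSum_hermOfUpper {k : ℕ} (hk : k ≤ n) :
    ConvexOn ℝ Set.univ (fun z : UpperIndex n → ℂ => topSum (isHermitian_hermOfUpper z) k) :=
  ⟨convex_univ, fun x _ y _ a b ha hb _ =>
    topSum_convex _ _ _ hk ha hb (hermOfUpper_combination a b x y)⟩

lemma topSum_hermOfUpper_sub_le {D : ℝ} (hD : 0 < D) {k : ℕ} (hk : k ≤ n)
    (x y : UpperIndex n → ℂ) :
    topSum (isHermitian_hermOfUpper x) k - topSum (isHermitian_hermOfUpper y) k ≤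
      √(8 * k * D ^ 2) * √(entryCost D (x - y)) := by
  refine (topSum_sub_le _ _ hk).trans ?_
  rw [← Real.sqrt_mul (by positivity), ← Real.sqrt_mul (by positivity), ← hermOfUpper_sub]
  refine Real.sqrt_le_sqrt ?_
  have := mul_le_mul_of_nonneg_left (sum_sq_hermOfUpper_le hD (x - y)) (Nat.cast_nonneg (α := ℝ) k)
  linarith

end HermOfUpper

lemma topSum_eq_hermOfUpper {Ω : Type*} {n : ℕ} {Z : Ω → UpperIndex n → ℂ}
    {Y : Ω → Matrix (Fin n) (Fin n) ℂ} (hY : ∀ ω, (Y ω).IsHermitian)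
    (hYZ : ∀ ω, hermOfUpper (Z ω) = Y ω) (k : ℕ) : (fun ω => topSum (hY ω) k) =
      fun ω => topSum (isHermitian_hermOfUpper (Z ω)) k := by
  funext ω
  have : ∀ {A B : Matrix (Fin n) (Fin n) ℂ} (hA : A.IsHermitian) (hB : B.IsHermitian), A = B →
      topSum hA k = topSum hB k := by
    rintro A B hA hB rfl; rfl
  exact this _ _ (hYZ ω).symm

/-! ### Concentration of eigenvalue sums and of single eigenvalues. -/

section Concentration

variable {Ω : Type*} [MeasurableSpace Ω] {μ : Measure Ω} {n : ℕ}
  {Z : Ω → UpperIndex n → ℂ} {Y : Ω → Matrix (Fin n) (Fin n) ℂ}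

lemma IsMedian.neg {Y : Ω → ℝ} {m : ℝ} (h : IsMedian μ Y m) :
    IsMedian μ (fun ω => -Y ω) (-m) := by
  refine ⟨?_, ?_⟩
  · simpa only [neg_le_neg_iff] using h.2
  · simpa only [neg_le_neg_iff] using h.1

lemma convexTau_neg_entries (hZ : Measurable Z) {D : ℝ}
    (hτ : ConvexTau (μ.map Z) (entryCost D)) :
    ConvexTau (μ.map fun ω => -Z ω) (entryCost D) := by
  have h := hτ.map (entryCost_nonneg D) (convexOn_entryCost D) (-LinearMap.id)
    (fun z => by simp [entryCost])
  rw [Measure.map_map (LinearMap.continuous_of_finiteDimensional _).measurable hZ] at h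
  exact h

variable [IsProbabilityMeasure μ]

lemma convexTau_entries {D : ℝ} (hD : 0 < D) {X : Ω → Matrix (Fin n) (Fin n) ℂ}
    (hmeas : ∀ j k, Measurable (fun ω => X ω j k)) (hherm : ∀ ω, (X ω).IsHermitian)
    (hindep : iIndepFun
      (fun (p : {p : Fin n × Fin n // p.1 ≤ p.2}) (ω : Ω) => X ω p.1.1 p.1.2) μ)
    (hdiag : ∀ j, SupportedInInterval μ (fun ω => (X ω j j).re) (√2 * D))
    (hoff : ∀ j k, j < k →
      SupportedInDiam μ (fun ω => X ω j k) D ∨ IsScaledIndepPair μ (fun ω => X ω j k) D) :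
    ConvexTau (μ.map fun ω (p : UpperIndex n) => X ω p.1.1 p.1.2) (entryCost D) := by
  rw [(iIndepFun_iff_map_fun_eq_pi_map fun p => (hmeas _ _).aemeasurable).1 hindep]
  have := fun p : UpperIndex n =>
    Measure.isProbabilityMeasure_map (μ := μ) (hmeas p.1.1 p.1.2).aemeasurable
  refine ConvexTau.pi _ (c := fun p z => ‖z‖ ^ 2 / (4 * entryDiam D p ^ 2))
    (fun p z => by positivity) (fun p => convexOn_sq_norm_div _ (by positivity)) ?_
  rintro ⟨⟨j, k⟩, hjk⟩
  rcases (show j ≤ k from hjk).eq_or_lt with rfl | h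
  · simp only [entryDiam, if_true]
    exact (hdiag j).convexTau_ofReal (hmeas j j) (fun ω => (hherm ω).coe_re_apply_self j)
      (by positivity)
  · simp only [entryDiam, h.ne, if_false]
    rcases hoff j k h with h' | h'
    · exact h'.convexTau (hmeas j k) hD
    · exact h'.convexTau hD

lemma measurable_topSum (hZ : Measurable Z) (hY : ∀ ω, (Y ω).IsHermitian)
    (hYZ : ∀ ω, hermOfUpper (Z ω) = Y ω) {k : ℕ} (hk : k ≤ n) :
    Measurable (fun ω => topSum (hY ω) k) := by
  rw [topSum_eq_hermOfUpper hY hYZ]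
  exact (convexOn_topSum_hermOfUpper hk).measurable_of_finiteDimensional.comp hZ

lemma topSum_concentration {D : ℝ} (hD : 0 < D) (hZ : Measurable Z)
    (hτ : ConvexTau (μ.map Z) (entryCost D)) (hY : ∀ ω, (Y ω).IsHermitian)
    (hYZ : ∀ ω, hermOfUpper (Z ω) = Y ω) {k : ℕ} (hk1 : 1 ≤ k) (hk : k ≤ n) {m : ℝ}
    (hm : IsMedian μ (fun ω => topSum (hY ω) k) m) {t : ℝ} (ht : 0 < t) :
    μ.real {ω | t ≤ |topSum (hY ω) k - m|} ≤ 4 * Real.exp (-(t ^ 2 / (8 * k * D ^ 2))) := by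
  have hk0 : (0 : ℝ) < k := by exact_mod_cast hk1
  have e := topSum_eq_hermOfUpper hY hYZ k
  rw [e] at hm
  have h := hτ.measureReal_le_of_isMedian hZ (entryCost_nonneg D) (convexOn_topSum_hermOfUpper hk)
    (L := √(8 * k * D ^ 2)) (by positivity) (topSum_hermOfUpper_sub_le hD hk) hm ht
  rw [div_pow, Real.sq_sqrt (by positivity)] at h
  simpa only [congrFun e] using h

/-- The deviation bound for the `k`-th eigenvalue. -/
noncomputable def kthBound (D t : ℝ) (k : ℕ) : ℝ :=
  8 * Real.exp (-(t / (2 * √2 * (√(k : ℝ) + √((k : ℝ) - 1)) * D)) ^ 2)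

/-- A centre obtained for the smaller of two indices then also serves the larger one. -/
lemma kthBound_mono {D t : ℝ} (hD : 0 < D) (ht : 0 < t) {j k : ℕ} (hj : 1 ≤ j) (hjk : j ≤ k) :
    kthBound D t j ≤ kthBound D t k := by
  have h1 : (0 : ℝ) < j := by exact_mod_cast hj
  have h2 : (j : ℝ) ≤ k := by exact_mod_cast hjk
  unfold kthBound
  gcongr

lemma exists_kthEigenvalue_concentration {D : ℝ} (hD : 0 < D) (hZ : Measurable Z)
    (hτ : ConvexTau (μ.map Z) (entryCost D)) (hY : ∀ ω, (Y ω).IsHermitian)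
    (hYZ : ∀ ω, hermOfUpper (Z ω) = Y ω) {k : ℕ} (hk2 : 2 ≤ k) (hk : k ≤ n) :
    ∃ M : ℝ, ∀ t, 0 < t →
      μ.real {ω | t ≤ |kthEigenvalue (hY ω) k - M|} ≤ kthBound D t k := by
  obtain ⟨k, rfl⟩ : ∃ l, k = l + 1 := ⟨k - 1, by omega⟩
  obtain ⟨m₁, hm₁⟩ := exists_isMedian μ (measurable_topSum hZ hY hYZ hk)
  obtain ⟨m₀, hm₀⟩ := exists_isMedian μ (measurable_topSum hZ hY hYZ (k := k) (by omega))
  refine ⟨m₁ - m₀, fun t ht => ?_⟩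
  have hk0 : (0 : ℝ) < k := by exact_mod_cast (by omega : 0 < k)
  set p := √((k + 1 : ℕ) : ℝ) with hp
  set q := √(k : ℝ) with hq
  have hp0 : 0 < p := Real.sqrt_pos.2 (by positivity)
  have hq0 : 0 < q := Real.sqrt_pos.2 hk0
  have hp2 : p ^ 2 = ((k + 1 : ℕ) : ℝ) := Real.sq_sqrt (by positivity)
  have hq2 : q ^ 2 = (k : ℝ) := Real.sq_sqrt hk0.le
  -- The threshold t is split in the ratio p : q of the Lipschitz constants, so both exponents
  -- become t²/(8D²(p + q)²) and the two factors 4 add up to 8.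
  have h1 := topSum_concentration hD hZ hτ hY hYZ (by omega) hk hm₁
    (t := t * p / (p + q)) (by positivity)
  have h0 := topSum_concentration hD hZ hτ hY hYZ (by omega) (by omega) hm₀
    (t := t * q / (p + q)) (by positivity)
  have hexp : kthBound D t (k + 1) = 8 * Real.exp (-(t ^ 2 / (8 * D ^ 2 * (p + q) ^ 2))) := by
    rw [kthBound, ← hp]
    rw [show ((k + 1 : ℕ) : ℝ) - 1 = k by push_cast; ring, ← hq]
    congr 3
    rw [div_pow, mul_pow, mul_pow, mul_pow, Real.sq_sqrt zero_le_two]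
    ring
  rw [show (t * p / (p + q)) ^ 2 / (8 * ((k + 1 : ℕ) : ℝ) * D ^ 2) =
    t ^ 2 / (8 * D ^ 2 * (p + q) ^ 2) by rw [← hp2]; field_simp] at h1
  rw [show (t * q / (p + q)) ^ 2 / (8 * (k : ℝ) * D ^ 2) =
    t ^ 2 / (8 * D ^ 2 * (p + q) ^ 2) by rw [← hq2]; field_simp] at h0
  have hsub : {ω | t ≤ |kthEigenvalue (hY ω) (k + 1) - (m₁ - m₀)|} ⊆
      {ω | t * p / (p + q) ≤ |topSum (hY ω) (k + 1) - m₁|} ∪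
        {ω | t * q / (p + q) ≤ |topSum (hY ω) k - m₀|} := by
    intro ω hω
    have hω' : t ≤ |kthEigenvalue (hY ω) (k + 1) - (m₁ - m₀)| := hω
    by_contra hcon
    simp only [Set.mem_union, Set.mem_ofPred_eq, not_or, not_le] at hcon
    have hsplit : kthEigenvalue (hY ω) (k + 1) - (m₁ - m₀) =
        (topSum (hY ω) (k + 1) - m₁) - (topSum (hY ω) k - m₀) := by
      rw [topSum_succ]; ring
    have htri := abs_sub (topSum (hY ω) (k + 1) - m₁) (topSum (hY ω) k - m₀)
    have hadd : t * p / (p + q) + t * q / (p + q) = t := by field_simp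
    rw [hsplit] at hω'
    linarith [hcon.1, hcon.2]
  refine ((measureReal_mono hsub).trans (measureReal_union_le _ _)).trans ?_
  rw [hexp]
  linarith

lemma kthBound_le {D t : ℝ} (hD : 0 < D) {k : ℕ} (hk : 1 ≤ k) :
    kthBound D t k ≤ 8 * Real.exp (-(t ^ 2 / (32 * (k : ℝ) * D ^ 2))) := by
  have hk0 : (0 : ℝ) < k := by exact_mod_cast hk
  have hp0 : 0 < √(k : ℝ) := Real.sqrt_pos.2 hk0
  have hq0 : 0 ≤ √((k : ℝ) - 1) := Real.sqrt_nonneg _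
  have hqp : √((k : ℝ) - 1) ≤ √(k : ℝ) := Real.sqrt_le_sqrt (by linarith)
  have hp2 : √(k : ℝ) ^ 2 = k := Real.sq_sqrt hk0.le
  unfold kthBound
  rw [div_pow]
  gcongr
  rw [mul_pow, mul_pow, mul_pow, Real.sq_sqrt zero_le_two]
  have : (√(k : ℝ) + √((k : ℝ) - 1)) ^ 2 ≤ 4 * k := by nlinarith
  nlinarith [mul_le_mul_of_nonneg_right this (sq_nonneg D)]

end Concentration

theorem theorem2 {Ω : Type*} [MeasurableSpace Ω] (μ : Measure Ω) [IsProbabilityMeasure μ]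
    (n : ℕ) (hn : 1 ≤ n) (D : ℝ) (hD : 0 < D)
    (X : Ω → Matrix (Fin n) (Fin n) ℂ)
    (hmeas : ∀ j k, Measurable (fun ω => X ω j k))
    (hherm : ∀ ω, (X ω).IsHermitian)
    (hindep : iIndepFun
      (fun (p : {p : Fin n × Fin n // p.1 ≤ p.2}) (ω : Ω) => X ω p.1.1 p.1.2) μ)
    (hdiag : ∀ j, SupportedInInterval μ (fun ω => (X ω j j).re) (√2 * D))
    (hoff : ∀ j k, j < k →
      SupportedInDiam μ (fun ω => X ω j k) D ∨ IsScaledIndepPair μ (fun ω => X ω j k) D) :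
    (∀ m : ℝ, IsMedian μ (fun ω => kthEigenvalue (hherm ω) 1) m → ∀ t : ℝ, 0 < t →
      μ.real {ω | t ≤ |kthEigenvalue (hherm ω) 1 - m|} ≤ 4 * Real.exp (-(t ^ 2 / (8 * D ^ 2)))) ∧
    (∀ m : ℝ, IsMedian μ (fun ω => kthEigenvalue (hherm ω) n) m → ∀ t : ℝ, 0 < t →
      μ.real {ω | t ≤ |kthEigenvalue (hherm ω) n - m|} ≤ 4 * Real.exp (-(t ^ 2 / (8 * D ^ 2)))) ∧
    (∃ M : ℕ → ℝ, ∀ k : ℕ, 2 ≤ k → k ≤ n - 1 → ∀ t : ℝ, 0 < t →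
      μ.real {ω | t ≤ |kthEigenvalue (hherm ω) k - M k|} ≤
        8 * Real.exp (-(t / (2 * √2 * (√(k : ℝ) + √((k : ℝ) - 1)) * D)) ^ 2) ∧
      μ.real {ω | t ≤ |kthEigenvalue (hherm ω) (n - k + 1) - M (n - k + 1)|} ≤
        8 * Real.exp (-(t / (2 * √2 * (√(k : ℝ) + √((k : ℝ) - 1)) * D)) ^ 2) ∧
      8 * Real.exp (-(t / (2 * √2 * (√(k : ℝ) + √((k : ℝ) - 1)) * D)) ^ 2) ≤
        8 * Real.exp (-(t ^ 2 / (32 * (k : ℝ) * D ^ 2)))) := by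
  set Z : Ω → UpperIndex n → ℂ := fun ω p => X ω p.1.1 p.1.2 with hZdef
  have hZ : Measurable Z := measurable_pi_iff.2 fun p => hmeas _ _
  have hτ : ConvexTau (μ.map Z) (entryCost D) :=
    convexTau_entries hD hmeas hherm hindep hdiag hoff
  have hXZ : ∀ ω, hermOfUpper (Z ω) = X ω := fun ω => hermOfUpper_eq (hherm ω)
  have hτ' := convexTau_neg_entries hZ hτ
  have hherm' : ∀ ω, (-X ω).IsHermitian := fun ω => (hherm ω).neg
  have hXZ' : ∀ ω, hermOfUpper (-Z ω) = -X ω := fun ω => by rw [hermOfUpper_neg, hXZ]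
  have hneg : ∀ j, 1 ≤ j → j ≤ n → ∀ ω,
      kthEigenvalue (hherm' ω) j = -kthEigenvalue (hherm ω) (n - j + 1) :=
    fun j h1 h2 ω => kthEigenvalue_neg (hherm ω) (hherm' ω) h1 h2
  refine ⟨fun m hm t ht => ?_, fun m hm t ht => ?_, ?_⟩
  · simp only [← topSum_one] at hm ⊢
    simpa using topSum_concentration hD hZ hτ hherm hXZ le_rfl hn hm ht
  -- λ_n(X) = -λ_1(-X), and property (τ) survives the sign change because the cost is even.
  · have hlast : ∀ ω, topSum (hherm' ω) 1 = -kthEigenvalue (hherm ω) n := fun ω => by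
      rw [topSum_one, hneg 1 le_rfl hn, Nat.sub_add_cancel hn]
    have hm' : IsMedian μ (fun ω => topSum (hherm' ω) 1) (-m) := by
      simpa only [hlast] using hm.neg
    have h := topSum_concentration hD hZ.neg hτ' hherm' hXZ' le_rfl hn hm' ht
    have habs : ∀ ω, |topSum (hherm' ω) 1 - -m| = |kthEigenvalue (hherm ω) n - m| := fun ω => by
      rw [hlast, ← abs_neg]; congr 1; ring
    simpa only [habs, Nat.cast_one, mul_one] using h
  -- The centre M j is used twice: for k = j from the top and for k = n - j + 1 from the bottom. It
  -- is built from X or from -X according to which index is smaller; monotonicity of `kthBound`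
  -- gives the other bound.
  · have hM : ∀ j : ℕ, ∃ M : ℝ, 2 ≤ j → j ≤ n - 1 → ∀ t, 0 < t →
        μ.real {ω | t ≤ |kthEigenvalue (hherm ω) j - M|} ≤ kthBound D t j ∧
        μ.real {ω | t ≤ |kthEigenvalue (hherm ω) j - M|} ≤ kthBound D t (n - j + 1) := by
      intro j
      by_cases hj : 2 ≤ j ∧ j ≤ n - 1
      · obtain ⟨hj2, hjn⟩ := hj
        rcases le_total j (n - j + 1) with hle | hle
        · obtain ⟨M, hM⟩ :=
            exists_kthEigenvalue_concentration hD hZ hτ hherm hXZ hj2 (by omega)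
          exact ⟨M, fun _ _ t ht => ⟨hM t ht, (hM t ht).trans
            (kthBound_mono hD ht (by omega) hle)⟩⟩
        · obtain ⟨M, hM⟩ := exists_kthEigenvalue_concentration hD hZ.neg hτ' hherm' hXZ'
            (k := n - j + 1) (by omega) (by omega)
          have habs : ∀ ω, |kthEigenvalue (hherm' ω) (n - j + 1) - M| =
              |kthEigenvalue (hherm ω) j - -M| := fun ω => by
            rw [hneg _ (by omega) (by omega), show n - (n - j + 1) + 1 = j by omega, ← abs_neg]
            congr 1; ring
          simp only [habs] at hM
          exact ⟨-M, fun _ _ t ht => ⟨(hM t ht).trans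
            (kthBound_mono hD ht (by omega) hle), hM t ht⟩⟩
      · exact ⟨0, fun h1 h2 => absurd ⟨h1, h2⟩ hj⟩
    choose M hM using hM
    refine ⟨M, fun k hk2 hkn t ht => ⟨(hM k hk2 hkn t ht).1, ?_, kthBound_le hD (by omega)⟩⟩
    have h := (hM (n - k + 1) (by omega) (by omega) t ht).2
    rwa [show n - (n - k + 1) + 1 = k by omega] at h
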